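/- Throughout, $A$ is a unital C*-algebra and $J$ a finite or countable index set. Hilbert $A$-modules are left modules whose $A$-valued inner product $\langle\cdot,\cdot\rangle$ is $A$-linear in the first variable, $\mathcal H\oplus\mathcal K$ carries the inner product $\langle h\oplus k,h'\oplus k'\rangle=\langle h,h'\rangle+\langle k,k'\rangle$, and $l_2(A)$ denotes the standard Hilbert $A$-module of families $(a_j)_j$ in $A$ for which $\sum_j a_ja_j^*$ converges in norm, with $\langle a,b\rangle=\sum_j a_jb_j^*$ (indexed by $J$ or by $\mathbb N$). **Definitions.** A family $(x_j)_{j\in J}$ in a Hilbert $A$-module $\mathcal H$ is a *standard frame* if there are real $C,D>0$ such that for all $x\in\mathcal H$ the sum $\sum_j\langle x,x_j\rangle\langle x_j,x\rangle$ converges in norm and $C\langle x,x\rangle\le\sum_j\langle x,x_j\rangle\langle x_j,x\rangle\le D\langle x,x\rangle$; it is *normalized tight* if this holds with $C=D=1$. Its *frame transform* is $\theta:\mathcal H\to l_2(A)$, $\theta(x)=(\langle x,x_j\rangle)_j$. A *Hilbert basis* of $\mathcal H$ is a family $(x_j)_j$ whose $A$-linear span is norm-dense in $\mathcal H$, such that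 a norm-convergent $A$-linear combination $\sum_{j\in S}a_jx_j$, $S\subseteq J$, equals zero only if every summand $a_jx_j$ does, and such that $ax_j=0$ with $a\in A$ implies $a=0$. It is *orthogonal* if $\langle x_i,x_j\rangle=0$ for $i\neq j$. A *standard Riesz basis* is a standard frame that is a Hilbert basis. Let $(x_j)_j$, $(y_j)_j$ be standard frames of $\mathcal H$, $\mathcal K$, respectively. Two pairs $((x_j)_j,(y_j)_j)$ and $((z_j)_j,(w_j)_j)$ of families in $\mathcal H$, $\mathcal K$ are *similar* if there are invertible adjointable bounded operators $T_1$ on $\mathcal H$ and $T_2$ on $\mathcal K$ with $T_1x_j=z_j$ and $T_2y_j=w_j$ for all $j$. The frames $(x_j)_j$ and $(y_j)_j$ are - *strongly complementary* if the pair is similar to a pair of standard normalized tight frames $(z_j)_j$, $(w_j)_j$ of $\mathcal H$, $\mathcal K$ such that $(z_j\oplus w_j)_j$ is a standard normalized tight frame and an orthogonal Hilbert basis of $\mathcal H\oplus\mathcal K$; - *complementary* if $(x_j\oplus y_j)_j$ is a standard Riesz basis of $\mathcal H\oplus\mathcal K$; - *strongly disjoint* if the pair is similar to a pair of standard normalized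 tight frames $(z_j)_j$, $(w_j)_j$ of $\mathcal H$, $\mathcal K$ such that $(z_j\oplus w_j)_j$ is a standard normalized tight frame of $\mathcal H\oplus\mathcal K$; - *disjoint* if $(x_j\oplus y_j)_j$ is a standard frame of $\mathcal H\oplus\mathcal K$; - *weakly disjoint* if the only element of $\mathcal H\oplus\mathcal K$ orthogonal to all $x_j\oplus y_j$ is $0$. **Theorem.** Let $(x_j)_{j\in J}$ and $(y_j)_{j\in J}$ be standard frames of finitely or countably generated Hilbert $A$-modules $\mathcal H$ and $\mathcal K$ with $\mathcal H\oplus\mathcal K\cong l_2(A)$ (unitarily), and let $\theta_1,\theta_2$ be their frame transforms. Then there are unique orthogonal projections $P$ and $Q$ on $l_2(A)$ with ranges $\theta_1(\mathcal H)$ and $\theta_2(\mathcal K)$, and: 1. $(x_j)_j$ and $(y_j)_j$ are strongly complementary if and only if $P=\mathrm{id}-Q$. 2. They are complementary if and only if $P(l_2(A))\cap Q(l_2(A))=\{0\}$ and $P(l_2(A))+Q(l_2(A))=l_2(A)$; equivalently, if and only if $P(l_2(A))\cap Q(l_2(A))=\{0\}$ and $P+Q$ is invertible. 3. They are strongly disjoint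 if and only if $PQ=QP=0$. 4. They are disjoint if and only if $P(l_2(A))\cap Q(l_2(A))=\{0\}$ and $P(l_2(A))+Q(l_2(A))$ is norm-closed. 5. They are weakly disjoint if and only if $P(l_2(A))\cap Q(l_2(A))=\{0\}$. -/

import Mathlib

open scoped WithCStarModule

noncomputable section

/-! Mathlib's `inner A x y` on a Hilbert C⋆-module is `A`-linear in the *second* variable, so the
value `⟨x, y⟩` of an inner product that is `A`-linear in the *first* variable is `inner A y x`. -/

section SquareSummable

theorem summable_smul_mul_star {A : Type*} [CStarAlgebra A] {J : Type*}
    {R : Type*} [SMul R A] [IsScalarTower R A A] {a : J → A} (c : R)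
    (ha : Summable fun j => a j * star (a j)) :
    Summable fun j => (c • a j) * star (c • a j) := by
  have h := (ha.mul_left (c • (1 : A))).mul_right (star (c • (1 : A)))
  refine h.congr fun j => ?_
  have e : c • a j = (c • (1 : A)) * a j := by rw [smul_mul_assoc, one_mul]
  rw [e, star_mul]
  noncomm_ring

variable {A : Type*} [CStarAlgebra A] [PartialOrder A] [StarOrderedRing A] {J : Type*}

theorem summable_of_nonneg_of_le_cstar {f g : J → A} (h0 : ∀ j, 0 ≤ f j) (h : ∀ j, f j ≤ g j)
    (hg : Summable g) : Summable f := by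
  rw [summable_iff_vanishing_norm] at hg ⊢
  intro ε hε
  obtain ⟨s, hs⟩ := hg ε hε
  refine ⟨s, fun t ht => lt_of_le_of_lt ?_ (hs t ht)⟩
  exact CStarAlgebra.norm_le_norm_of_nonneg_of_le (Finset.sum_nonneg fun j _ => h0 j)
    (Finset.sum_le_sum fun j _ => h j)

theorem summable_add_mul_star {a b : J → A} (ha : Summable fun j => a j * star (a j))
    (hb : Summable fun j => b j * star (b j)) :
    Summable fun j => (a j + b j) * star (a j + b j) := by
  refine summable_of_nonneg_of_le_cstar (fun j => mul_star_self_nonneg _) (fun j => ?_)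
    ((ha.add hb).add (ha.add hb))
  have h := mul_star_self_nonneg (a j - b j)
  rw [← sub_nonneg]
  convert h using 1
  simp only [star_add, star_sub]
  noncomm_ring

theorem summable_mul_star_cstar {a b : J → A} (ha : Summable fun j => a j * star (a j))
    (hb : Summable fun j => b j * star (b j)) : Summable fun j => b j * star (a j) := by
  have key : ∀ c : ℂ, Summable fun j => (b j + c • a j) * star (b j + c • a j) :=
    fun c => summable_add_mul_star hb (summable_smul_mul_star c ha)
  have h := ((((key 1).sub (key (-1))).add ((key Complex.I).const_smul Complex.I)).sub
    ((key (-Complex.I)).const_smul Complex.I)).const_smul (1 / 4 : ℂ)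
  refine h.congr fun j => ?_
  simp only [star_add, star_smul, mul_add, add_mul, smul_mul_assoc, mul_smul_comm, smul_add,
    smul_sub, smul_smul]
  simp
  module

end SquareSummable

section StandardModule

variable (A : Type*) [CStarAlgebra A] [PartialOrder A] [StarOrderedRing A] (J : Type*)

/-- The square-summable `J`-indexed families in `A`: those for which `∑ j, a j * (a j)⋆` converges
in norm. -/
def squareSummable : Submodule A (J → A) where
  carrier := {a | Summable fun j => a j * star (a j)}
  add_mem' ha hb := summable_add_mul_star ha hb
  zero_mem' := by simp
  smul_mem' c _ ha := summable_smul_mul_star c ha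

/-- The standard Hilbert `A`-module `l₂(A)` of square-summable families indexed by `J`. It is a
type of its own, so that it does not inherit the topology of pointwise convergence. -/
def L2 : Type _ := squareSummable A J

namespace L2

instance : AddCommGroup (L2 A J) := inferInstanceAs (AddCommGroup (squareSummable A J))

instance : Module A (L2 A J) := inferInstanceAs (Module A (squareSummable A J))

instance : Module ℂ (L2 A J) := inferInstanceAs (Module ℂ (squareSummable A J))

variable {A J}

/-- The `j`-th coordinate. -/
def coord (a : L2 A J) (j : J) : A := a.1 j

theorem summable_coord (a b : L2 A J) : Summable fun j => b.coord j * star (a.coord j) :=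
  summable_mul_star_cstar a.2 b.2

theorem ext_coord {a b : L2 A J} (h : ∀ j, a.coord j = b.coord j) : a = b :=
  Subtype.ext (funext h)

instance : Inner A (L2 A J) := ⟨fun a b => ∑' j, b.coord j * star (a.coord j)⟩

instance : Norm (L2 A J) := ⟨fun a => √‖inner A a a‖⟩

instance : CStarModule A (L2 A J) where
  inner_add_right {x y z} := by
    refine Eq.trans ?_ ((summable_coord x y).tsum_add (summable_coord x z))
    exact tsum_congr fun j => add_mul _ _ _
  inner_self_nonneg := tsum_nonneg fun j => mul_star_self_nonneg _
  inner_self {x} := by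
    constructor
    · intro h
      have h1 := (summable_coord x x).hasSum
      change ∑' j, x.coord j * star (x.coord j) = 0 at h
      rw [h, hasSum_zero_iff_of_nonneg fun j => mul_star_self_nonneg _] at h1
      refine ext_coord fun j => ?_
      exact (CStarRing.mul_star_self_eq_zero_iff _).1 (congrFun h1 j)
    · rintro rfl
      exact (tsum_congr fun j => zero_mul _).trans tsum_zero
  inner_op_smul_right {a x y} := by
    refine Eq.trans ?_ ((summable_coord x y).tsum_mul_left a)
    exact tsum_congr fun j => mul_assoc _ _ _
  inner_smul_right_complex {z x y} := by
    refine Eq.trans ?_ ((summable_coord x y).tsum_const_smul z)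
    exact tsum_congr fun j => smul_mul_assoc _ _ _
  star_inner x y := by
    refine (tsum_star).trans ?_
    exact tsum_congr fun j => by rw [star_mul, star_star]
  norm_eq_sqrt_norm_inner_self _ := rfl

instance : NormedAddCommGroup (L2 A J) := CStarModule.normedAddCommGroup A

instance : NormedSpace ℂ (L2 A J) := NormedSpace.ofCore (CStarModule.normedSpaceCore A)

end L2

end StandardModule

section Frames

variable (A : Type*) [CStarAlgebra A] [PartialOrder A] [StarOrderedRing A] {J : Type*}
variable {E : Type*} [NormedAddCommGroup E] [NormedSpace ℂ E] [Module A E] [CStarModule A E]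
variable {F : Type*} [NormedAddCommGroup F] [NormedSpace ℂ F] [Module A F] [CStarModule A F]

/-- `C` and `D` are a lower and an upper bound of the standard frame `x`: the sum
`∑ j, ⟨z, x j⟩ ⟨x j, z⟩` converges in norm for all `z`, and lies between `C ⟨z, z⟩` and
`D ⟨z, z⟩`. -/
structure IsStandardFrameWith (C D : ℝ) (x : J → E) : Prop where
  summable : ∀ z : E, Summable fun j => inner A (x j) z * inner A z (x j)
  lower : ∀ z : E, C • inner A z z ≤ ∑' j, inner A (x j) z * inner A z (x j)
  upper : ∀ z : E, ∑' j, inner A (x j) z * inner A z (x j) ≤ D • inner A z z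

/-- Standard frames of the Hilbert `A`-module `E`. -/
def IsStandardFrame (x : J → E) : Prop :=
  ∃ C D : ℝ, 0 < C ∧ 0 < D ∧ IsStandardFrameWith A C D x

/-- Standard normalized tight frames. -/
def IsStandardNormalizedTightFrame (x : J → E) : Prop := IsStandardFrameWith A 1 1 x

variable {A} in
/-- The frame transform `z ↦ (⟨z, x j⟩)_j` of a standard frame. -/
def frameTransform (x : J → E) (hx : IsStandardFrame A x) : E →ₗ[A] L2 A J where
  toFun z := ⟨fun j => inner A (x j) z, by
    obtain ⟨C, D, -, -, h⟩ := hx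
    exact (h.summable z).congr fun j => by rw [CStarModule.star_inner]⟩
  map_add' z w := L2.ext_coord fun j => CStarModule.inner_add_right
  map_smul' a z := L2.ext_coord fun j => CStarModule.inner_op_smul_right

/-- A Hilbert basis: a generating family such that a norm-convergent `A`-linear combination over
a subset of the index set vanishes only if all its summands do, and whose members have trivial
annihilator in `A` (over `ℂ`: are non-zero). For an orthogonal basis that is a normalized tight
frame the last condition says that every `⟨x j, x j⟩` is the unit of `A`. -/
structure IsHilbertBasis (x : J → E) : Prop where
  generating : Dense (Submodule.span A (Set.range x) : Set E)
  independent : ∀ (S : Set J) (a : J → A),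
    HasSum (fun j : S => a j • x j) 0 → ∀ j ∈ S, a j • x j = 0
  annihilator_trivial : ∀ (j : J) (a : A), a • x j = 0 → a = 0

/-- An orthogonal Hilbert basis. -/
def IsOrthogonalHilbertBasis (x : J → E) : Prop :=
  IsHilbertBasis A x ∧ ∀ i j, i ≠ j → inner A (x i) (x j) = 0

/-- A standard Riesz basis. -/
def IsStandardRieszBasis (x : J → E) : Prop := IsStandardFrame A x ∧ IsHilbertBasis A x

variable {A} in
/-- Adjointability of an operator between Hilbert `A`-modules. -/
def IsAdjointable (T : E →L[A] F) : Prop :=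
  ∃ S : F →L[A] E, ∀ (z : E) (w : F), inner A (T z) w = inner A z (S w)

/-- The inner sum `(x j ⊕ y j)_j` in the Hilbert `A`-module `E ⊕ F`. -/
def innerSum (x : J → E) (y : J → F) (j : J) : C⋆ᵐᵒᵈ(A, E × F) :=
  (WithCStarModule.equiv A (E × F)).symm (x j, y j)

/-- Similarity of the pairs `(x, y)` and `(z, w)`: an operator `T₁ ⊕ T₂` with invertible adjointable
`T₁` and `T₂` maps `x j ⊕ y j` to `z j ⊕ w j` for all `j`. -/
def SimilarPairs (x : J → E) (y : J → F) (z : J → E) (w : J → F) : Prop :=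
  ∃ (T₁ : E ≃L[A] E) (T₂ : F ≃L[A] F), IsAdjointable (T₁ : E →L[A] E) ∧
    IsAdjointable (T₂ : F →L[A] F) ∧ ∀ j, T₁ (x j) = z j ∧ T₂ (y j) = w j

/-- `x` and `y` are similar to a pair of standard normalized tight frames whose inner sum is a
standard normalized tight frame and an orthogonal Hilbert basis. -/
def StronglyComplementary (x : J → E) (y : J → F) : Prop :=
  ∃ (z : J → E) (w : J → F), SimilarPairs A x y z w ∧
    IsStandardNormalizedTightFrame A z ∧ IsStandardNormalizedTightFrame A w ∧
    IsStandardNormalizedTightFrame A (innerSum A z w) ∧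
    IsOrthogonalHilbertBasis A (innerSum A z w)

/-- The inner sum is a standard Riesz basis. -/
def Complementary (x : J → E) (y : J → F) : Prop := IsStandardRieszBasis A (innerSum A x y)

/-- `x` and `y` are similar to a pair of standard normalized tight frames whose inner sum is a
standard normalized tight frame. -/
def StronglyDisjoint (x : J → E) (y : J → F) : Prop :=
  ∃ (z : J → E) (w : J → F), SimilarPairs A x y z w ∧
    IsStandardNormalizedTightFrame A z ∧ IsStandardNormalizedTightFrame A w ∧
    IsStandardNormalizedTightFrame A (innerSum A z w)

/-- The inner sum is a standard frame. -/
def DisjointFrames (x : J → E) (y : J → F) : Prop := IsStandardFrame A (innerSum A x y)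

/-- The inner sum has trivial orthogonal complement. -/
def WeaklyDisjoint (x : J → E) (y : J → F) : Prop :=
  ∀ v : C⋆ᵐᵒᵈ(A, E × F), (∀ j, inner A (innerSum A x y j) v = 0) → v = 0

variable {A} in
/-- `P` is the orthogonal projection onto the submodule `R`. -/
structure IsOrthogonalProjectionOnto (P : E →L[A] E) (R : Submodule A E) : Prop where
  idempotent : P * P = P
  selfAdjoint : ∀ z w : E, inner A (P z) w = inner A z (P w)
  range_eq : (P : E →ₗ[A] E).range = R

variable (E F) in
/-- Unitary equivalence of Hilbert `A`-modules. -/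
def UnitarilyIsomorphic : Prop :=
  ∃ U : E ≃ₗ[A] F, ∀ z w : E, inner A (U z) (U w) = inner A z w

end Frames

end

/-!
The analysis operator `Θ z = (⟨z, x j⟩)_j` translates properties of a family `x` in a Hilbert
`A`-module into properties of an operator into `l₂(A)`, and the analysis operator of the inner sum
`(x j ⊕ y j)_j` is `Θ = Θ₁ + Θ₂ : h ⊕ k ↦ Θ₁ h + Θ₂ k`. Its range is the sum of the ranges of `P`
and `Q`, and it is injective exactly if these ranges meet trivially, since `Θ₁` and `Θ₂` are
injective. Each of the five conditions is a condition on `Θ`: weak disjointness says that `Θ` is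
injective, disjointness that it is injective with closed range, complementarity that it is
bijective, and the two strong versions that the ranges of `Θ₁` and `Θ₂` are orthogonal and, for
strong complementarity, span `l₂(A)`.

Two facts stand in for Hilbert space theory. Paschke's inequality `inner_le_of_norm_le` upgrades
norm estimates between `A`-linear maps to `A`-valued ones, so that a family with an analysis
operator is a frame as soon as that operator is bounded below in norm; for Banach spaces this means
injectivity and closed range, `l₂(A)` being complete. And a symmetric operator `S` with
`C ⟨z, z⟩ ≤ ⟨S z, z⟩` for some `C > 0` has a symmetric inverse square root `T`
(`exists_symmetric_inverse_sqrt`), found by a fixed point argument that avoids the functional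
calculus of the C⋆-algebra of adjointable operators. Applied to `S = Θ⋆ Θ`, this gives the
projection `Θ T T Θ⋆` onto the range of `Θ` and the normalized tight frame `(T (x j))_j` similar
to `x`.

For bijective `Θ` the preimages of the standard basis of `l₂(A)` are biorthogonal to the family,
which makes it a Hilbert basis; conversely the independence of a Hilbert basis says that the
synthesis operator `Θ⋆ : a ↦ ∑ j, a j • x j` is injective, whence the frame `x` has a surjective
`Θ`. Finally, the ranges of two projections span if and only if `P + Q` is invertible, by the open
mapping theorem and Paschke's inequality.
-/

set_option linter.unusedSectionVars false

/-! ### Paschke's inequality and inverse square roots of coercive operators -/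

section HilbertModule

variable {A : Type*} [CStarAlgebra A] [PartialOrder A]
variable {E : Type*} [NormedAddCommGroup E] [NormedSpace ℂ E] [Module A E] [CStarModule A E]
variable {F : Type*} [NormedAddCommGroup F] [NormedSpace ℂ F] [Module A F] [CStarModule A F]
variable {G : Type*} [AddCommGroup G] [Module A G]

variable (A) in
theorem eq_of_forall_inner_right {z w : E} (h : ∀ u : E, inner A u z = inner A u w) : z = w := by
  rw [← sub_eq_zero, ← CStarModule.inner_self (A := A), CStarModule.inner_sub_right, h, sub_self]

variable (A) in
theorem eq_zero_of_forall_inner_right {z : E} (h : ∀ u : E, inner A u z = 0) : z = 0 :=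
  eq_of_forall_inner_right A fun u => by rw [h, CStarModule.inner_zero_right]

variable (A E) in
/-- The complex scalars act on a Hilbert `A`-module through the multiples of the unit of `A`:
both actions have the same inner products. -/
theorem CStarModule.isScalarTower_complex : IsScalarTower ℂ A E where
  smul_assoc c a z := by
    refine eq_of_forall_inner_right A fun u => ?_
    rw [CStarModule.inner_op_smul_right, CStarModule.inner_smul_right_complex,
      CStarModule.inner_op_smul_right, smul_mul_assoc]

theorem inner_swap_eq_zero {z w : E} (h : inner A z w = 0) : inner A w z = 0 := by
  rw [← CStarModule.star_inner, h, star_zero]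

/-- A symmetric map is automatically `A`-linear. -/
theorem map_smul_of_symmetric {T : E → E} (hT : ∀ z w : E, inner A (T z) w = inner A z (T w))
    (a : A) (z : E) : T (a • z) = a • T z :=
  eq_of_forall_inner_right A fun u => by
    rw [← hT, CStarModule.inner_op_smul_right, hT, CStarModule.inner_op_smul_right]

variable [StarOrderedRing A]

theorem inner_add_self_of_inner_eq_zero {z w : E} (h : inner A z w = 0) :
    inner A (z + w) (z + w) = inner A z z + inner A w w := by
  rw [CStarModule.inner_add_left, CStarModule.inner_add_right, CStarModule.inner_add_right, h,
    inner_swap_eq_zero h, add_zero, zero_add]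

theorem norm_le_mul_of_inner_le {z : E} {w : F} {M : ℝ} (hM : 0 ≤ M)
    (h : inner A z z ≤ M ^ 2 • inner A w w) : ‖z‖ ≤ M * ‖w‖ := by
  refine abs_le_of_sq_le_sq' ?_ (by positivity) |>.2
  rw [mul_pow, CStarModule.norm_sq_eq A, CStarModule.norm_sq_eq A (x := w)]
  refine (CStarAlgebra.norm_le_norm_of_nonneg_of_le CStarModule.inner_self_nonneg h).trans ?_
  rw [norm_smul, Real.norm_of_nonneg (by positivity)]

/-- Paschke's inequality: a norm estimate between `A`-linear maps into Hilbert modules upgrades to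
an estimate between `A`-valued inner products. The norm estimate is applied to the multiple of `v`
by `(⟨g v, g v⟩ + ε)^(-1/2)`, whose image under `g` lies in the unit ball. -/
theorem inner_le_of_norm_le (f : G →ₗ[A] E) (g : G →ₗ[A] F) {M : ℝ} (hM : 0 ≤ M)
    (h : ∀ v, ‖f v‖ ≤ M * ‖g v‖) (v : G) :
    inner A (f v) (f v) ≤ M ^ 2 • inner A (g v) (g v) := by
  have key : ∀ ε : ℝ, 0 < ε →
      inner A (f v) (f v) ≤ M ^ 2 • (inner A (g v) (g v) + algebraMap ℝ A ε) := by
    intro ε hε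
    set p : A := inner A (g v) (g v) with hp
    have hp0 : 0 ≤ p := CStarModule.inner_self_nonneg
    set a : A := p + algebraMap ℝ A ε with ha
    have hpos : IsStrictlyPositive a :=
      IsStrictlyPositive.nonneg_add hp0 (isStrictlyPositive_algebraMap hε)
    set b : A := a ^ (-(1 / 2) : ℝ) with hb
    set d : A := a ^ (1 / 2 : ℝ) with hd
    have hbs : star b = b := (CFC.rpow_nonneg (a := a)).isSelfAdjoint
    have hds : star d = d := (CFC.rpow_nonneg (a := a)).isSelfAdjoint
    have hbab : b * a * b = 1 := CFC.conjugate_rpow_neg_one_half a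
    have hdb : d * b = 1 := CFC.rpow_mul_rpow_neg _ hpos
    have hbd : b * d = 1 := CFC.rpow_neg_mul_rpow _ hpos
    have hdd : d * d = a := by
      rw [hd, ← CFC.rpow_add hpos.isUnit]; norm_num
      exact CFC.rpow_one a
    have hg : ‖g (b • v)‖ ≤ 1 := by
      refine (sq_le_one_iff₀ (norm_nonneg _)).1 ?_
      rw [CStarModule.norm_sq_eq A, CStarAlgebra.norm_le_one_iff_of_nonneg _
        CStarModule.inner_self_nonneg, map_smul, CStarModule.inner_op_smul_left,
        CStarModule.inner_op_smul_right, hbs, ← hp, ← hbab]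
      have := star_left_conjugate_le_conjugate
        (show p ≤ a from le_add_of_nonneg_right (isStrictlyPositive_algebraMap hε).nonneg) b
      rwa [hbs] at this
    have hf : inner A (f (b • v)) (f (b • v)) ≤ algebraMap ℝ A (M ^ 2) := by
      rw [← CStarAlgebra.norm_le_iff_le_algebraMap _ (by positivity)
        CStarModule.inner_self_nonneg, ← CStarModule.norm_sq_eq A]
      exact pow_le_pow_left₀ (norm_nonneg _)
        ((h _).trans (mul_le_of_le_one_right hM hg)) 2
    rw [map_smul, CStarModule.inner_op_smul_left, CStarModule.inner_op_smul_right, hbs] at hf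
    have := star_left_conjugate_le_conjugate hf d
    rw [hds] at this
    have e : d * (b * inner A (f v) (f v) * b) * d = inner A (f v) (f v) := by
      calc _ = (d * b) * inner A (f v) (f v) * (b * d) := by noncomm_ring
        _ = _ := by rw [hdb, hbd, one_mul, mul_one]
    have e' : d * algebraMap ℝ A (M ^ 2) * d = M ^ 2 • a := by
      rw [← Algebra.commutes, mul_assoc, hdd, Algebra.smul_def]
    rwa [e, e'] at this
  have lim : Filter.Tendsto
      (fun ε : ℝ => M ^ 2 • (inner A (g v) (g v) + algebraMap ℝ A ε)) (nhdsWithin 0 (Set.Ioi 0))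
      (nhds (M ^ 2 • (inner A (g v) (g v) + algebraMap ℝ A 0))) := by
    refine Filter.Tendsto.mono_left ?_ nhdsWithin_le_nhds
    refine Continuous.tendsto (f := fun ε : ℝ => M ^ 2 • (inner A (g v) (g v) + algebraMap ℝ A ε))
      ?_ 0
    have := continuous_algebraMap ℝ A
    fun_prop
  rw [map_zero, add_zero] at lim
  exact ge_of_tendsto lim (Filter.eventually_of_mem self_mem_nhdsWithin key)

variable (A) in
/-- A square root of `1 - R` for a symmetric strict contraction `R`. It is `1 - Y` for the fixed
point `Y` of the map `Y ↦ (R + Y²) / 2`, a contraction of the complete set of symmetric operators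
of norm at most `‖R‖`. -/
theorem exists_symmetric_sqrt_one_sub [CompleteSpace E] (R : E →L[ℂ] E)
    (hR : ∀ z w : E, inner A (R z) w = inner A z (R w)) (hR1 : ‖R‖ < 1) :
    ∃ Y : E →L[ℂ] E, (∀ z w : E, inner A (Y z) w = inner A z (Y w)) ∧ ‖Y‖ < 1 ∧
      (1 - Y) * (1 - Y) = 1 - R := by
  set s : Set (E →L[ℂ] E) :=
    {Y | ‖Y‖ ≤ ‖R‖ ∧ ∀ z w : E, inner A (Y z) w = inner A z (Y w)} with hs
  have hclosed : IsClosed s := by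
    refine (isClosed_le continuous_norm continuous_const).inter ?_
    have e : {Y : E →L[ℂ] E | ∀ z w : E, inner A (Y z) w = inner A z (Y w)} =
        ⋂ z, ⋂ w, {Y | inner A (Y z) w = inner A z (Y w)} := by ext Y; simp
    change IsClosed {Y : E →L[ℂ] E | ∀ z w : E, inner A (Y z) w = inner A z (Y w)}
    rw [e]
    refine isClosed_iInter fun z => isClosed_iInter fun w => isClosed_eq ?_ ?_
    · exact CStarModule.continuous_inner.comp
        (((ContinuousLinearMap.apply ℂ E z).continuous).prodMk continuous_const)
    · exact CStarModule.continuous_inner.comp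
        (continuous_const.prodMk ((ContinuousLinearMap.apply ℂ E w).continuous))
  set f : (E →L[ℂ] E) → (E →L[ℂ] E) := fun Y => (1 / 2 : ℂ) • (R + Y * Y) with hf
  have hmaps : Set.MapsTo f s s := by
    rintro Y ⟨h1, h2⟩
    refine ⟨?_, fun z w => ?_⟩
    · rw [hf, norm_smul]
      have h3 : ‖R + Y * Y‖ ≤ ‖R‖ + ‖Y‖ * ‖Y‖ :=
        (norm_add_le _ _).trans (by gcongr; exact norm_mul_le _ _)
      have h4 : ‖(1 / 2 : ℂ)‖ = 1 / 2 := by norm_num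
      rw [h4]
      nlinarith [norm_nonneg Y, norm_nonneg R]
    · simp [hf, CStarModule.inner_smul_left_complex, CStarModule.inner_add_left, hR, h2]
  have hcontr : ContractingWith ‖R‖₊ (hmaps.restrict f s s) := by
    refine ⟨by exact_mod_cast hR1, LipschitzWith.of_dist_le_mul ?_⟩
    rintro ⟨Y, hY, -⟩ ⟨Z, hZ, -⟩
    simp only [Subtype.dist_eq, Set.MapsTo.val_restrict_apply, dist_eq_norm, coe_nnnorm]
    have e : f Y - f Z = (1 / 2 : ℂ) • (Y * (Y - Z) + (Y - Z) * Z) := by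
      simp only [hf, ← smul_sub]; congr 1; noncomm_ring
    have h3 : ‖Y * (Y - Z) + (Y - Z) * Z‖ ≤ ‖R‖ * ‖Y - Z‖ + ‖Y - Z‖ * ‖R‖ :=
      (norm_add_le _ _).trans (add_le_add
        ((norm_mul_le _ _).trans (by gcongr)) ((norm_mul_le _ _).trans (by gcongr)))
    have h4 : ‖(1 / 2 : ℂ)‖ = 1 / 2 := by norm_num
    rw [e, norm_smul, h4]
    linarith
  obtain ⟨Y, ⟨hY1, hY2⟩, hfix, -⟩ := hcontr.exists_fixedPoint' hclosed.isComplete hmaps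
    (x := 0) ⟨by simp, by simp⟩ (edist_ne_top _ _)
  refine ⟨Y, hY2, hY1.trans_lt hR1, ?_⟩
  have h5 : R + Y * Y = (2 : ℂ) • Y := by
    conv_rhs => rw [← hfix.eq]
    simp [hf, smul_smul]
  have h6 : R = (2 : ℂ) • Y - Y * Y := by rw [← h5]; abel
  rw [h6, two_smul]; noncomm_ring

/-- A symmetric operator `S` with `C ⟨z, z⟩ ≤ ⟨S z, z⟩` for some `C > 0` has an inverse square root
`T`: for small `t > 0` the operator `1 - t S` is a strict contraction, so that `t S` has an
invertible symmetric square root. -/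
theorem exists_symmetric_inverse_sqrt [CompleteSpace E] (S : E →L[A] E)
    (hS : ∀ z w : E, inner A (S z) w = inner A z (S w)) {C : ℝ} (hC : 0 < C)
    (hle : ∀ z : E, C • inner A z z ≤ inner A (S z) z) :
    ∃ T : E ≃L[A] E, (∀ z w : E, inner A (T z) w = inner A z (T w)) ∧ ∀ z, T (S (T z)) = z := by
  have := CStarModule.isScalarTower_complex A E
  set S' : E →L[ℂ] E := S.restrictScalars ℂ with hS'
  set n := ‖S'‖ with hn
  -- This choice of `t` gives `t ^ 2 * n ^ 2 ≤ t * C` and `2 * t * C ≤ 1`.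
  set t : ℝ := C / (n ^ 2 + 2 * C ^ 2) with ht
  have hden : 0 < n ^ 2 + 2 * C ^ 2 := by positivity
  have ht0 : 0 < t := by positivity
  have htd : t * (n ^ 2 + 2 * C ^ 2) = C := by rw [ht]; field_simp
  set R : E →L[ℂ] E := 1 - (t : ℂ) • S' with hRdef
  have hRapp : ∀ z, R z = z - (t : ℂ) • S z := fun z => rfl
  have hR : ∀ z w : E, inner A (R z) w = inner A z (R w) := by
    intro z w
    simp [hRapp, hS]
  have htC : 0 ≤ 1 - 2 * (t * C) := by
    have h1 : (n ^ 2 + 2 * C ^ 2) * (1 - 2 * (t * C)) = n ^ 2 := by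
      linear_combination (-2 * C) * htd
    nlinarith [sq_nonneg n]
  have htn : t ^ 2 * n ^ 2 ≤ t * C := by
    have : t ^ 2 * n ^ 2 = t * (C - t * (2 * C ^ 2)) := by linear_combination t * htd
    rw [this]
    have : 0 ≤ t * (2 * C ^ 2) := by positivity
    nlinarith
  have hR1 : ‖R‖ < 1 := by
    have hb : ‖R‖ ≤ √(1 - t * C) := by
      refine ContinuousLinearMap.opNorm_le_bound _ (Real.sqrt_nonneg _) fun z => ?_
      have h0 : 0 ≤ 1 - t * C := by nlinarith [mul_pos ht0 hC]
      refine abs_le_of_sq_le_sq' ?_ (by positivity) |>.2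
      rw [mul_pow, Real.sq_sqrt h0]
      have e : inner A (R z) (R z) = inner A z z - (2 * t) • inner A (S z) z
          + t ^ 2 • inner A (S z) (S z) := by
        have e1 : (t : ℂ) • S z = t • S z := rfl
        rw [hRapp, e1]
        simp only [CStarModule.inner_sub_left, CStarModule.inner_sub_right,
          CStarModule.inner_smul_left_real, CStarModule.inner_smul_right_real, ← hS z z]
        module
      have h1 : inner A (R z) (R z) ≤ (1 - 2 * (t * C)) • inner A z z
          + t ^ 2 • inner A (S z) (S z) := by
        rw [e]
        have h2 := smul_le_smul_of_nonneg_left (hle z) (show (0 : ℝ) ≤ 2 * t by positivity)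
        have e2 : (1 - 2 * (t * C)) • inner A z z = inner A z z - (2 * t) • C • inner A z z := by
          module
        rw [e2]
        gcongr
      have h3 := CStarAlgebra.norm_le_norm_of_nonneg_of_le CStarModule.inner_self_nonneg h1
      have h4 := h3.trans (norm_add_le _ _)
      rw [norm_smul, norm_smul, Real.norm_of_nonneg htC, Real.norm_of_nonneg (sq_nonneg t),
        ← CStarModule.norm_sq_eq A, ← CStarModule.norm_sq_eq A, ← CStarModule.norm_sq_eq A] at h4
      have h5 : ‖S z‖ ≤ n * ‖z‖ := S'.le_opNorm z
      have h6 : ‖S z‖ ^ 2 ≤ n ^ 2 * ‖z‖ ^ 2 := by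
        rw [← mul_pow]; exact pow_le_pow_left₀ (norm_nonneg _) h5 2
      have h7 : t ^ 2 * ‖S z‖ ^ 2 ≤ t * C * ‖z‖ ^ 2 :=
        calc _ ≤ t ^ 2 * (n ^ 2 * ‖z‖ ^ 2) := by gcongr
          _ = t ^ 2 * n ^ 2 * ‖z‖ ^ 2 := by ring
          _ ≤ _ := by gcongr
      nlinarith
    refine hb.trans_lt ?_
    rw [Real.sqrt_lt' one_pos]
    nlinarith [mul_pos ht0 hC]
  obtain ⟨Y, hY, hY1, hYR⟩ := exists_symmetric_sqrt_one_sub A R hR hR1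
  set B : E ≃L[ℂ] E := ContinuousLinearEquiv.unitsEquiv ℂ E (Units.oneSub Y hY1) with hB
  have hBapp : ∀ z, B z = z - Y z := fun z => rfl
  have hBB : ∀ z, B (B z) = (t : ℂ) • S z := by
    intro z
    have := congrArg (fun L : E →L[ℂ] E => L z) hYR
    have e : (1 : E →L[ℂ] E) - R = (t : ℂ) • S' := by rw [hRdef]; abel
    rw [e] at this
    exact this
  have hBsymm : ∀ z w : E, inner A (B.symm z) w = inner A z (B.symm w) := by
    intro z w
    have h1 : ∀ u v : E, inner A (B u) v = inner A u (B v) := fun u v => by simp [hBapp, hY]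
    have h2 := h1 (B.symm z) (B.symm w)
    rw [B.apply_symm_apply, B.apply_symm_apply] at h2
    exact h2.symm
  have hr0 : (√t : ℂ) ≠ 0 := by exact_mod_cast (Real.sqrt_pos.2 ht0).ne'
  have hrr : (√t : ℂ) * (√t : ℂ) = t := by exact_mod_cast Real.mul_self_sqrt ht0.le
  have hTs : ∀ z w : E, inner A ((√t : ℂ) • B.symm z) w = inner A z ((√t : ℂ) • B.symm w) := by
    intro z w
    simp [hBsymm]
  let T : E ≃L[A] E :=
    { toFun := fun z => (√t : ℂ) • B.symm z
      invFun := fun z => B ((√t : ℂ)⁻¹ • z)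
      map_add' := fun z w => by simp
      map_smul' := map_smul_of_symmetric hTs
      left_inv := fun z => by
        change B ((√t : ℂ)⁻¹ • (√t : ℂ) • B.symm z) = z
        rw [smul_smul, inv_mul_cancel₀ hr0, one_smul, B.apply_symm_apply]
      right_inv := fun z => by simp [smul_smul, hr0]
      continuous_toFun := (B.symm.continuous).const_smul _
      continuous_invFun := B.continuous.comp (continuous_const_smul _) }
  refine ⟨T, hTs, fun z => ?_⟩
  have h8 : ∀ u, S u = (t : ℂ)⁻¹ • B (B u) := by
    intro u
    rw [hBB, smul_smul, inv_mul_cancel₀, one_smul]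
    exact_mod_cast ht0.ne'
  change (√t : ℂ) • B.symm (S ((√t : ℂ) • B.symm z)) = z
  have e : (√t : ℂ) * (t : ℂ)⁻¹ * √t = 1 := by
    rw [← hrr]; field_simp
  rw [h8, map_smul, map_smul, map_smul, B.apply_symm_apply, map_smul, B.symm_apply_apply,
    smul_smul, smul_smul, e, one_smul]

end HilbertModule

/-! ### Adjointable operators with closed range, and projections -/

section Adjointable

variable {A : Type*} [CStarAlgebra A] [PartialOrder A] [StarOrderedRing A]
variable {E : Type*} [NormedAddCommGroup E] [NormedSpace ℂ E] [Module A E] [CStarModule A E]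
variable {F : Type*} [NormedAddCommGroup F] [NormedSpace ℂ F] [Module A F] [CStarModule A F]

theorem exists_norm_le_mul (Θ : E →L[A] F) : ∃ M : ℝ, 0 ≤ M ∧ ∀ z, ‖Θ z‖ ≤ M * ‖z‖ := by
  have := CStarModule.isScalarTower_complex A E
  have := CStarModule.isScalarTower_complex A F
  exact ⟨‖Θ.restrictScalars ℂ‖, norm_nonneg _, (Θ.restrictScalars ℂ).le_opNorm⟩

/-- A map with an everywhere defined adjoint is `A`-linear and bounded. -/
theorem exists_continuousLinearMap_of_adjoint (Θ : E →L[A] F) (S : F → E)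
    (hS : ∀ z w, inner A (Θ z) w = inner A z (S w)) : ∃ S' : F →L[A] E, ∀ w, S' w = S w := by
  obtain ⟨M, hM, hΘ⟩ := exists_norm_le_mul Θ
  let S' : F →ₗ[A] E :=
    { toFun := S
      map_add' := fun v w => eq_of_forall_inner_right A fun u => by
        rw [CStarModule.inner_add_right, ← hS, ← hS, ← hS, CStarModule.inner_add_right]
      map_smul' := fun a w => eq_of_forall_inner_right A fun u => by
        rw [RingHom.id_apply, CStarModule.inner_op_smul_right, ← hS, ← hS,
          CStarModule.inner_op_smul_right] }
  refine ⟨⟨S', AddMonoidHomClass.continuous_of_bound S' M fun w => ?_⟩, fun w => rfl⟩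
  rcases (norm_nonneg (S w)).eq_or_lt with h0 | h0
  · exact h0.symm.le.trans (by positivity)
  · refine le_of_mul_le_mul_left ?_ h0
    calc ‖S w‖ * ‖S w‖ = ‖inner A (Θ (S w)) w‖ := by
          rw [hS, ← CStarModule.norm_sq_eq A, sq]
      _ ≤ ‖Θ (S w)‖ * ‖w‖ := CStarModule.norm_inner_le F
      _ ≤ M * ‖S w‖ * ‖w‖ := by gcongr; exact hΘ _
      _ = ‖S w‖ * (M * ‖w‖) := by ring

/-- For a bounded below operator `Θ` with adjoint `S`, the operator `S Θ` has a symmetric inverse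
square root `T`; thus `Θ T` is an isometry. -/
theorem exists_symmetric_adjoint_comp_eq [CompleteSpace E] (Θ : E →L[A] F) (S : F →L[A] E)
    (hS : ∀ z w, inner A (Θ z) w = inner A z (S w)) {M : ℝ} (hM : 0 < M)
    (hΘ : ∀ z, ‖z‖ ≤ M * ‖Θ z‖) :
    ∃ T : E ≃L[A] E, (∀ z w : E, inner A (T z) w = inner A z (T w)) ∧
      ∀ z, T (S (Θ (T z))) = z := by
  have hS' : ∀ z w, inner A (S w) z = inner A w (Θ z) := fun z w => by
    rw [← CStarModule.star_inner, ← hS, CStarModule.star_inner]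
  refine exists_symmetric_inverse_sqrt (S.comp Θ) (fun z w => ?_) (C := (M ^ 2)⁻¹)
    (by positivity) fun z => ?_
  · simp [hS, hS']
  · have h := inner_le_of_norm_le (LinearMap.id : E →ₗ[A] E) (Θ : E →ₗ[A] F) hM.le hΘ z
    have h1 := smul_le_smul_of_nonneg_left h (show 0 ≤ (M ^ 2)⁻¹ by positivity)
    rw [smul_smul, inv_mul_cancel₀ (by positivity), one_smul] at h1
    simpa [hS'] using h1

theorem comp_eq_of_symmetric_comp_eq {Θ : E →L[A] F} {S : F →L[A] E} {T : E ≃L[A] E}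
    (hT : ∀ z, T (S (Θ (T z))) = z) (z : E) : S (Θ (T (T z))) = z :=
  T.injective (hT (T z))

/-- The range of a bounded below adjointable operator `Θ` is orthogonally complemented: with the
adjoint `S` and the inverse square root `T` of `S Θ`, the projection is `Θ T T S`. -/
theorem exists_isOrthogonalProjectionOnto_range [CompleteSpace E] (Θ : E →L[A] F) (S : F →L[A] E)
    (hS : ∀ z w, inner A (Θ z) w = inner A z (S w)) {M : ℝ} (hM : 0 < M)
    (hΘ : ∀ z, ‖z‖ ≤ M * ‖Θ z‖) :
    ∃ P : F →L[A] F, IsOrthogonalProjectionOnto P (Θ : E →ₗ[A] F).range := by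
  obtain ⟨T, hT, hTS⟩ := exists_symmetric_adjoint_comp_eq Θ S hS hM hΘ
  have hS' : ∀ z w, inner A (S w) z = inner A w (Θ z) := fun z w => by
    rw [← CStarModule.star_inner, ← hS, CStarModule.star_inner]
  have hST := comp_eq_of_symmetric_comp_eq hTS
  have hTTS : ∀ z, T (T (S (Θ z))) = z := fun z => by
    obtain ⟨w, rfl⟩ := T.surjective z
    rw [hTS]
  refine ⟨Θ.comp ((T : E →L[A] E).comp ((T : E →L[A] E).comp S)), ?_, fun z w => ?_, ?_⟩
  · ext w
    simp [hTTS]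
  · simp [hS, hT, hS']
  · refine le_antisymm ?_ ?_
    · rintro _ ⟨w, rfl⟩
      exact ⟨_, rfl⟩
    · rintro _ ⟨z, rfl⟩
      exact ⟨Θ z, congrArg Θ (hTTS z)⟩

/-- Since `S Θ T T = 1`, every `w` has the same image under `S` as `Θ (T (T (S w)))`. -/
theorem surjective_of_adjoint_injective [CompleteSpace E] (Θ : E →L[A] F) (S : F →L[A] E)
    (hS : ∀ z w, inner A (Θ z) w = inner A z (S w)) {M : ℝ} (hM : 0 < M)
    (hΘ : ∀ z, ‖z‖ ≤ M * ‖Θ z‖) (hinj : Function.Injective S) : Function.Surjective Θ := by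
  obtain ⟨T, -, hTS⟩ := exists_symmetric_adjoint_comp_eq Θ S hS hM hΘ
  exact fun w => ⟨T (T (S w)), hinj (comp_eq_of_symmetric_comp_eq hTS (S w))⟩

/-- The bounded inverse theorem for operators with closed range. -/
theorem exists_norm_le_iff [CompleteSpace E] [CompleteSpace F] (Θ : E →L[A] F) :
    (∃ M : ℝ, 0 < M ∧ ∀ z, ‖z‖ ≤ M * ‖Θ z‖) ↔
      Function.Injective Θ ∧ IsClosed (Set.range Θ) := by
  have := CStarModule.isScalarTower_complex A E
  have := CStarModule.isScalarTower_complex A F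
  have key := (Θ.restrictScalars ℂ).isClosed_range_iff_antilipschitz_of_injective
  constructor
  · rintro ⟨M, hM, h⟩
    have h1 : AntilipschitzWith ⟨M, hM.le⟩ (Θ.restrictScalars ℂ) :=
      AddMonoidHomClass.antilipschitz_of_bound (Θ.restrictScalars ℂ) h
    exact ⟨h1.injective, (key h1.injective).2 ⟨_, h1⟩⟩
  · rintro ⟨hinj, hcl⟩
    obtain ⟨K, hK⟩ := (key hinj).1 hcl
    refine ⟨K + 1, by positivity, fun z => ?_⟩
    have h1 := hK.le_mul_dist z 0
    rw [map_zero, dist_zero_right, dist_zero_right] at h1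
    refine h1.trans ?_
    gcongr
    · simp
    · rfl

/-- Polarization: an `A`-linear map that preserves `⟨z, z⟩` preserves all inner products. -/
theorem inner_map_map_of_inner_self (f : E →ₗ[A] F)
    (hf : ∀ z, inner A (f z) (f z) = inner A z z) (z w : E) :
    inner A (f z) (f w) = inner A z w := by
  -- The defect of `f` is skew; at `i • w` this says that it is also symmetric.
  have key : ∀ v, inner A (f z) (f v) - inner A z v + (inner A (f v) (f z) - inner A v z) = 0 := by
    intro v
    have h := hf (z + v)
    simp only [map_add, CStarModule.inner_add_left, CStarModule.inner_add_right, hf] at h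
    rw [← sub_eq_zero] at h
    rw [← h]
    abel
  have h1 := key w
  have h2 := key (algebraMap ℂ A Complex.I • w)
  simp only [map_smul, CStarModule.inner_op_smul_left, CStarModule.inner_op_smul_right] at h2
  rw [← algebraMap_star_comm, ← Algebra.commutes, ← Algebra.commutes] at h2
  simp only [← Algebra.smul_def, RCLike.star_def, Complex.conj_I] at h2
  set p := inner A (f z) (f w) - inner A z w with hp
  set q := inner A (f w) (f z) - inner A w z with hq
  have h3 : Complex.I • (p - q) = 0 := by
    rw [← h2, hp, hq]; module
  have h4 : p - q = 0 := (smul_eq_zero.1 h3).resolve_left Complex.I_ne_zero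
  have h5 : (2 : ℂ) • p = 0 := by
    have : (2 : ℂ) • p = (p + q) + (p - q) := by module
    rw [this, h1, h4, add_zero]
  exact sub_eq_zero.1 ((smul_eq_zero.1 h5).resolve_left two_ne_zero)

end Adjointable

section Projection

variable {A : Type*} [CStarAlgebra A] [PartialOrder A] [StarOrderedRing A]
variable {E : Type*} [NormedAddCommGroup E] [NormedSpace ℂ E] [Module A E] [CStarModule A E]

namespace IsOrthogonalProjectionOnto

variable {P Q : E →L[A] E} {R R' : Submodule A E}

theorem apply_mem (hP : IsOrthogonalProjectionOnto P R) (v : E) : P v ∈ R :=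
  hP.range_eq ▸ ⟨v, rfl⟩

theorem apply_eq_self (hP : IsOrthogonalProjectionOnto P R) {v : E} (hv : v ∈ R) : P v = v := by
  rw [← hP.range_eq] at hv
  obtain ⟨w, rfl⟩ := hv
  exact congrArg (fun L : E →L[A] E => L w) hP.idempotent

theorem unique (hP : IsOrthogonalProjectionOnto P R) (hQ : IsOrthogonalProjectionOnto Q R) :
    P = Q := by
  ext v
  refine eq_of_forall_inner_right A fun u => ?_
  rw [← hP.selfAdjoint, ← hQ.selfAdjoint, ← hQ.apply_eq_self (hP.apply_mem u), hQ.selfAdjoint,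
    hP.selfAdjoint, hP.apply_eq_self (hQ.apply_mem v), hQ.selfAdjoint]

theorem mul_eq_zero_iff (hP : IsOrthogonalProjectionOnto P R)
    (hQ : IsOrthogonalProjectionOnto Q R') :
    P * Q = 0 ↔ ∀ u ∈ R, ∀ w ∈ R', inner A u w = 0 := by
  constructor
  · intro h u hu w hw
    rw [← hP.apply_eq_self hu, hP.selfAdjoint, ← hQ.apply_eq_self hw]
    have : P (Q w) = 0 := congrArg (fun L : E →L[A] E => L w) h
    rw [this, CStarModule.inner_zero_right]
  · intro h
    ext v
    refine eq_zero_of_forall_inner_right A fun u => ?_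
    change inner A u (P (Q v)) = 0
    rw [← hP.selfAdjoint]
    exact h _ (hP.apply_mem u) _ (hQ.apply_mem v)

theorem mul_eq_zero_comm (hP : IsOrthogonalProjectionOnto P R)
    (hQ : IsOrthogonalProjectionOnto Q R') : P * Q = 0 ↔ Q * P = 0 := by
  rw [hP.mul_eq_zero_iff hQ, hQ.mul_eq_zero_iff hP]
  constructor <;> intro h u hu w hw <;>
    rw [← CStarModule.star_inner, h w hw u hu, star_zero]

theorem eq_one_sub_iff (hP : IsOrthogonalProjectionOnto P R)
    (hQ : IsOrthogonalProjectionOnto Q R') : P = 1 - Q ↔ P * Q = 0 ∧ R ⊔ R' = ⊤ := by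
  constructor
  · intro h
    refine ⟨by rw [h, sub_mul, one_mul, hQ.idempotent, sub_self], eq_top_iff.2 fun v _ => ?_⟩
    refine Submodule.mem_sup.2 ⟨P v, hP.apply_mem v, Q v, hQ.apply_mem v, ?_⟩
    rw [h]
    simp
  · rintro ⟨h, ht⟩
    have h' := (hP.mul_eq_zero_comm hQ).1 h
    ext v
    obtain ⟨a, ha, b, hb, rfl⟩ := Submodule.mem_sup.1 (ht ▸ Submodule.mem_top : v ∈ R ⊔ R')
    have h1 : P b = 0 := by
      rw [← hQ.apply_eq_self hb]; exact congrArg (fun L : E →L[A] E => L b) h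
    have h2 : Q a = 0 := by
      rw [← hP.apply_eq_self ha]; exact congrArg (fun L : E →L[A] E => L a) h'
    simp [h1, h2, hP.apply_eq_self ha, hQ.apply_eq_self hb]

/-- If the ranges of two projections span, the open mapping theorem bounds `v = P a + Q b` with
`a` and `b` of norm at most `M ‖v‖`, so that `‖v‖² = ‖⟨P v, a⟩ + ⟨Q v, b⟩‖` bounds `v` by `P v` and
`Q v`. By Paschke's inequality `P + Q` is then bounded below as a positive operator. -/
theorem isUnit_add_iff [CompleteSpace E] (hP : IsOrthogonalProjectionOnto P R)
    (hQ : IsOrthogonalProjectionOnto Q R') : IsUnit (P + Q) ↔ R ⊔ R' = ⊤ := by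
  constructor
  · intro h
    refine eq_top_iff.2 fun v _ => ?_
    obtain ⟨U, hU⟩ := h
    have h1 : (P + Q) (U⁻¹.1 v) = v := by
      rw [← hU]; exact congrArg (fun L : E →L[A] E => L v) U.mul_inv
    rw [← h1]
    exact Submodule.add_mem_sup (hP.apply_mem _) (hQ.apply_mem _)
  · intro h
    have := CStarModule.isScalarTower_complex A E
    set f : E × E →L[ℂ] E :=
      (P.restrictScalars ℂ).comp (ContinuousLinearMap.fst ℂ E E) +
        (Q.restrictScalars ℂ).comp (ContinuousLinearMap.snd ℂ E E) with hf
    have hfapp : ∀ p, f p = P p.1 + Q p.2 := fun p => rfl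
    have hsurj : Function.Surjective f := fun v => by
      obtain ⟨a, ha, b, hb, rfl⟩ := Submodule.mem_sup.1 (h ▸ Submodule.mem_top : v ∈ R ⊔ R')
      exact ⟨(a, b), by rw [hfapp, hP.apply_eq_self ha, hQ.apply_eq_self hb]⟩
    obtain ⟨M, hM, hfM⟩ := f.exists_preimage_norm_le hsurj
    let g : E →ₗ[A] C⋆ᵐᵒᵈ(A, E × E) :=
      (WithCStarModule.linearEquiv A A (E × E)).symm.toLinearMap ∘ₗ
        ((P : E →ₗ[A] E).prod (Q : E →ₗ[A] E))
    have hg1 : ∀ v, (g v).1 = P v := fun v => rfl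
    have hg2 : ∀ v, (g v).2 = Q v := fun v => rfl
    have hPP : ∀ v, P (P v) = P v := fun v => hP.apply_eq_self (hP.apply_mem v)
    have hQQ : ∀ v, Q (Q v) = Q v := fun v => hQ.apply_eq_self (hQ.apply_mem v)
    have hginner : ∀ v, inner A (g v) (g v) = inner A ((P + Q) v) v := by
      intro v
      rw [WithCStarModule.prod_inner, hg1, hg2, ← hP.selfAdjoint, hPP, ← hQ.selfAdjoint, hQQ,
        add_apply, CStarModule.inner_add_left]
    have hbound : ∀ v, ‖v‖ ≤ 2 * M * ‖g v‖ := by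
      intro v
      rcases (norm_nonneg v).eq_or_lt with h0 | h0
      · rw [← h0]; positivity
      obtain ⟨p, hp, hpM⟩ := hfM v
      refine le_of_mul_le_mul_left ?_ h0
      have hgP : ‖P v‖ ≤ ‖g v‖ := (le_max_left _ _).trans (WithCStarModule.max_le_prod_norm (g v))
      have hgQ : ‖Q v‖ ≤ ‖g v‖ := (le_max_right _ _).trans (WithCStarModule.max_le_prod_norm (g v))
      have e : inner A v v = inner A (P v) p.1 + inner A (Q v) p.2 := by
        have e1 : inner A v v = inner A v (f p) := by rw [hp]
        rw [e1, hfapp, CStarModule.inner_add_right, ← hP.selfAdjoint, ← hQ.selfAdjoint]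
      calc ‖v‖ * ‖v‖ = ‖inner A (P v) p.1 + inner A (Q v) p.2‖ := by
            rw [← e, ← CStarModule.norm_sq_eq A, sq]
        _ ≤ ‖P v‖ * ‖p.1‖ + ‖Q v‖ * ‖p.2‖ :=
            (norm_add_le _ _).trans
              (add_le_add (CStarModule.norm_inner_le E) (CStarModule.norm_inner_le E))
        _ ≤ ‖g v‖ * (M * ‖v‖) + ‖g v‖ * (M * ‖v‖) := by
            gcongr
            · exact (norm_fst_le p).trans hpM
            · exact (norm_snd_le p).trans hpM
        _ = ‖v‖ * (2 * M * ‖g v‖) := by ring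
    obtain ⟨T, hT, hTS⟩ := exists_symmetric_inverse_sqrt (P + Q)
      (fun z w => by
        simp only [add_apply, CStarModule.inner_add_left,
          CStarModule.inner_add_right, hP.selfAdjoint, hQ.selfAdjoint])
      (C := ((2 * M) ^ 2)⁻¹) (by positivity) (fun z => by
        have h1 := smul_le_smul_of_nonneg_left
          (inner_le_of_norm_le LinearMap.id g (by positivity) hbound z)
          (show 0 ≤ ((2 * M) ^ 2)⁻¹ by positivity)
        rw [smul_smul, inv_mul_cancel₀ (by positivity), one_smul, hginner] at h1
        exact h1)
    refine isUnit_iff_exists.2 ⟨(T : E →L[A] E) * T, ?_, ?_⟩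
    · ext z
      exact T.injective (hTS (T z))
    · ext z
      obtain ⟨w, rfl⟩ := T.surjective z
      exact congrArg T (hTS w)

end IsOrthogonalProjectionOnto

end Projection

/-! ### The standard module, analysis operators and frames -/

namespace L2

variable {A : Type*} [CStarAlgebra A] [PartialOrder A] [StarOrderedRing A] {J : Type*}

theorem inner_def (a b : L2 A J) : inner A a b = ∑' j, b.coord j * star (a.coord j) := rfl

theorem coord_add (a b : L2 A J) (j : J) : (a + b).coord j = a.coord j + b.coord j := rfl

theorem coord_zero (j : J) : (0 : L2 A J).coord j = 0 := rfl

theorem sum_le_inner_self (a : L2 A J) (s : Finset J) :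
    ∑ j ∈ s, a.coord j * star (a.coord j) ≤ inner A a a :=
  (summable_coord a a).sum_le_tsum s fun _ _ => mul_star_self_nonneg _

theorem norm_sum_le (a : L2 A J) (s : Finset J) :
    ‖∑ j ∈ s, a.coord j * star (a.coord j)‖ ≤ ‖a‖ ^ 2 := by
  rw [CStarModule.norm_sq_eq A]
  exact CStarAlgebra.norm_le_norm_of_nonneg_of_le
    (Finset.sum_nonneg fun j _ => mul_star_self_nonneg _) (sum_le_inner_self a s)

theorem norm_coord_le (a : L2 A J) (j : J) : ‖a.coord j‖ ≤ ‖a‖ := by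
  have h := norm_sum_le a {j}
  rw [Finset.sum_singleton, CStarRing.norm_self_mul_star, ← sq] at h
  exact abs_le_of_sq_le_sq' h (norm_nonneg _) |>.2

theorem norm_le_of_forall_sum_le (a : L2 A J) {r : ℝ} (hr : 0 ≤ r)
    (h : ∀ s : Finset J, ‖∑ j ∈ s, a.coord j * star (a.coord j)‖ ≤ r ^ 2) : ‖a‖ ≤ r := by
  refine abs_le_of_sq_le_sq' ?_ hr |>.2
  rw [CStarModule.norm_sq_eq A]
  exact le_of_tendsto (summable_coord a a).hasSum.norm (Filter.Eventually.of_forall h)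

theorem add_mul_star_add_le (a b : A) :
    (a + b) * star (a + b) ≤ (a * star a + b * star b) + (a * star a + b * star b) := by
  have h := mul_star_self_nonneg (a - b)
  rw [← sub_nonneg]
  convert h using 1
  simp only [star_add, star_sub]
  noncomm_ring

/-- A family which is uniformly close to square-summable families on all finite sets is itself
square-summable. -/
theorem summable_of_forall_norm_sum_sub_le (f : J → A)
    (h : ∀ ε : ℝ, 0 < ε → ∃ u : L2 A J, ∀ s : Finset J,
      ‖∑ j ∈ s, (f j - u.coord j) * star (f j - u.coord j)‖ ≤ ε) :
    Summable fun j => f j * star (f j) := by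
  rw [summable_iff_vanishing_norm]
  intro ε hε
  obtain ⟨u, hu⟩ := h (ε / 8) (by positivity)
  obtain ⟨s, hs⟩ := summable_iff_vanishing_norm.1 (summable_coord u u) (ε / 8) (by positivity)
  refine ⟨s, fun t ht => ?_⟩
  have h1 : ∑ j ∈ t, f j * star (f j) ≤
      (∑ j ∈ t, (f j - u.coord j) * star (f j - u.coord j)
        + ∑ j ∈ t, u.coord j * star (u.coord j)) +
      (∑ j ∈ t, (f j - u.coord j) * star (f j - u.coord j)
        + ∑ j ∈ t, u.coord j * star (u.coord j)) := by
    rw [← Finset.sum_add_distrib, ← Finset.sum_add_distrib]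
    refine Finset.sum_le_sum fun j _ => ?_
    have := add_mul_star_add_le (f j - u.coord j) (u.coord j)
    rwa [sub_add_cancel] at this
  have h2 := CStarAlgebra.norm_le_norm_of_nonneg_of_le
    (Finset.sum_nonneg fun j _ => mul_star_self_nonneg _) h1
  have h3 := hu t
  have h4 := hs t ht
  refine h2.trans_lt ((norm_add_le _ _).trans_lt ?_)
  have h5 := norm_add_le (∑ j ∈ t, (f j - u.coord j) * star (f j - u.coord j))
    (∑ j ∈ t, u.coord j * star (u.coord j))
  linarith

instance : CompleteSpace (L2 A J) := by
  refine Metric.complete_of_cauchySeq_tendsto fun u hu => ?_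
  have hcoord : ∀ j, ∃ a, Filter.Tendsto (fun n => (u n).coord j) Filter.atTop (nhds a) := by
    intro j
    refine cauchySeq_tendsto_of_complete (Metric.cauchySeq_iff.2 fun ε hε => ?_)
    obtain ⟨N, hN⟩ := Metric.cauchySeq_iff.1 hu ε hε
    refine ⟨N, fun m hm n hn => lt_of_le_of_lt ?_ (hN m hm n hn)⟩
    rw [dist_eq_norm, dist_eq_norm]
    exact norm_coord_le (u m - u n) j
  choose f hf using hcoord
  -- Cauchy estimates on finite partial sums survive the coordinatewise limit.
  have key : ∀ ε : ℝ, 0 < ε → ∃ N, ∀ n ≥ N, ∀ s : Finset J,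
      ‖∑ j ∈ s, (f j - (u n).coord j) * star (f j - (u n).coord j)‖ ≤ ε ^ 2 := by
    intro ε hε
    obtain ⟨N, hN⟩ := Metric.cauchySeq_iff.1 hu ε hε
    refine ⟨N, fun n hn s => ?_⟩
    have hlim : Filter.Tendsto
        (fun m => ‖∑ j ∈ s, (u m - u n).coord j * star ((u m - u n).coord j)‖)
        Filter.atTop
        (nhds ‖∑ j ∈ s, (f j - (u n).coord j) * star (f j - (u n).coord j)‖) := by
      refine (tendsto_finsetSum _ fun j _ => ?_).norm
      have := (hf j).sub_const ((u n).coord j)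
      exact this.mul this.star
    refine le_of_tendsto hlim (Filter.eventually_atTop.2 ⟨N, fun m hm => ?_⟩)
    refine (norm_sum_le _ s).trans ?_
    have := hN m hm n hn
    rw [dist_eq_norm] at this
    gcongr
  let a : L2 A J := ⟨f, summable_of_forall_norm_sum_sub_le f fun ε hε => by
    obtain ⟨N, hN⟩ := key √ε (Real.sqrt_pos.2 hε)
    exact ⟨u N, fun s => (hN N le_rfl s).trans_eq (Real.sq_sqrt hε.le)⟩⟩
  refine ⟨a, Metric.tendsto_atTop.2 fun ε hε => ?_⟩
  obtain ⟨N, hN⟩ := key (ε / 2) (by positivity)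
  refine ⟨N, fun n hn => ?_⟩
  rw [dist_comm, dist_eq_norm]
  exact (norm_le_of_forall_sum_le (a - u n) (by positivity) (hN n hn)).trans_lt (by linarith)

open Classical in
/-- The family `f`, set to zero outside the finite set `s`. -/
noncomputable def ofFinset (s : Finset J) (f : J → A) : L2 A J :=
  ⟨fun j => if j ∈ s then f j else 0, summable_of_ne_finset_zero (s := s) fun j hj => by simp [hj]⟩

open Classical in
theorem coord_ofFinset (s : Finset J) (f : J → A) (j : J) :
    (ofFinset s f).coord j = if j ∈ s then f j else 0 := rfl

theorem inner_ofFinset_right (s : Finset J) (f : J → A) (a : L2 A J) :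
    inner A a (ofFinset s f) = ∑ j ∈ s, f j * star (a.coord j) := by
  rw [inner_def, tsum_eq_sum (s := s) fun j hj => by simp [coord_ofFinset, hj]]
  exact Finset.sum_congr rfl fun j hj => by simp [coord_ofFinset, hj]

theorem norm_ofFinset_sq (s : Finset J) (f : J → A) :
    ‖ofFinset s f‖ ^ 2 = ‖∑ j ∈ s, f j * star (f j)‖ := by
  rw [CStarModule.norm_sq_eq A, inner_ofFinset_right]
  congr 1
  exact Finset.sum_congr rfl fun j hj => by simp [coord_ofFinset, hj]

/-- The `j`-th vector of the standard orthonormal basis of `l₂(A)`. -/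
noncomputable def basisVector (j : J) : L2 A J := ofFinset {j} 1

theorem inner_basisVector_right (a : L2 A J) (j : J) :
    inner A a (basisVector j) = star (a.coord j) := by
  simp [basisVector, inner_ofFinset_right]

theorem coord_basisVector_of_ne {i j : J} (h : i ≠ j) : (basisVector j : L2 A J).coord i = 0 := by
  simp [basisVector, coord_ofFinset, h]

theorem coord_basisVector_self (j : J) : (basisVector j : L2 A J).coord j = 1 := by
  simp [basisVector, coord_ofFinset]

end L2

section Analysis

variable {A : Type*} [CStarAlgebra A] [PartialOrder A] [StarOrderedRing A] {J : Type*}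
variable {E : Type*} [NormedAddCommGroup E] [NormedSpace ℂ E] [Module A E] [CStarModule A E]

/-- `Θ` is the analysis operator `z ↦ (⟨z, x j⟩)_j` of the family `x`. Only families for which
this is an everywhere defined bounded operator into `l₂(A)`, the Bessel families, have one; for a
frame it is the frame transform. -/
def IsAnalysisOperator (x : J → E) (Θ : E →L[A] L2 A J) : Prop :=
  ∀ z j, (Θ z).coord j = inner A (x j) z

theorem IsStandardFrame.exists_isAnalysisOperator {x : J → E} (hx : IsStandardFrame A x) :
    ∃ Θ : E →L[A] L2 A J, IsAnalysisOperator x Θ ∧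
      (Θ : E →ₗ[A] L2 A J).range = (frameTransform x hx).range := by
  have hx' := hx
  obtain ⟨C, D, -, hD, h⟩ := hx'
  refine ⟨⟨frameTransform x hx, AddMonoidHomClass.continuous_of_bound (frameTransform x hx) √D
    fun z => ?_⟩,
    fun z j => rfl, rfl⟩
  refine norm_le_mul_of_inner_le (A := A) (Real.sqrt_nonneg D) ?_
  rw [Real.sq_sqrt hD.le]
  refine le_trans (le_of_eq ?_) (h.upper z)
  exact tsum_congr fun j => by rw [← CStarModule.star_inner (x j) z]; rfl

namespace IsAnalysisOperator

variable {x : J → E} {Θ : E →L[A] L2 A J}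

theorem hasSum (hΘ : IsAnalysisOperator x Θ) (z : E) :
    HasSum (fun j => inner A (x j) z * inner A z (x j)) (inner A (Θ z) (Θ z)) := by
  have h := (L2.summable_coord (Θ z) (Θ z)).hasSum
  rw [← L2.inner_def] at h
  simpa only [hΘ z, CStarModule.star_inner] using h

theorem isStandardFrameWith_iff (hΘ : IsAnalysisOperator x Θ) (C D : ℝ) :
    IsStandardFrameWith A C D x ↔
      ∀ z, C • inner A z z ≤ inner A (Θ z) (Θ z) ∧ inner A (Θ z) (Θ z) ≤ D • inner A z z := by
  constructor
  · intro h z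
    rw [← (hΘ.hasSum z).tsum_eq]
    exact ⟨h.lower z, h.upper z⟩
  · intro h
    exact ⟨fun z => (hΘ.hasSum z).summable, fun z => (hΘ.hasSum z).tsum_eq ▸ (h z).1,
      fun z => (hΘ.hasSum z).tsum_eq ▸ (h z).2⟩

theorem isStandardNormalizedTightFrame_iff (hΘ : IsAnalysisOperator x Θ) :
    IsStandardNormalizedTightFrame A x ↔ ∀ z, inner A (Θ z) (Θ z) = inner A z z := by
  rw [IsStandardNormalizedTightFrame, hΘ.isStandardFrameWith_iff]
  simp only [one_smul]
  exact forall_congr' fun z => ⟨fun h => le_antisymm h.2 h.1, fun h => ⟨h.ge, h.le⟩⟩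

/-- A family with an analysis operator `Θ` is a frame if and only if `Θ` is bounded below in norm:
Paschke's inequality turns a norm bound into the `A`-valued one. -/
theorem isStandardFrame_iff (hΘ : IsAnalysisOperator x Θ) :
    IsStandardFrame A x ↔ ∃ M : ℝ, 0 < M ∧ ∀ z, ‖z‖ ≤ M * ‖Θ z‖ := by
  constructor
  · rintro ⟨C, D, hC, -, h⟩
    refine ⟨(√C)⁻¹, by positivity, fun z => norm_le_mul_of_inner_le (A := A) (by positivity) ?_⟩
    have h1 := smul_le_smul_of_nonneg_left (((hΘ.isStandardFrameWith_iff C D).1 h z).1)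
      (inv_nonneg.2 hC.le)
    rwa [smul_smul, inv_mul_cancel₀ hC.ne', one_smul, ← Real.sq_sqrt hC.le, ← inv_pow] at h1
  · rintro ⟨M, hM, h⟩
    obtain ⟨N, hN, hΘN⟩ := exists_norm_le_mul Θ
    refine ⟨(M ^ 2)⁻¹, (N + 1) ^ 2, by positivity, by positivity,
      (hΘ.isStandardFrameWith_iff _ _).2 fun z => ⟨?_, ?_⟩⟩
    · have h1 := smul_le_smul_of_nonneg_left
        (inner_le_of_norm_le LinearMap.id (Θ : E →ₗ[A] L2 A J) hM.le h z)
        (show 0 ≤ (M ^ 2)⁻¹ by positivity)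
      rwa [smul_smul, inv_mul_cancel₀ (by positivity), one_smul] at h1
    · exact inner_le_of_norm_le (Θ : E →ₗ[A] L2 A J) LinearMap.id (by positivity)
        (fun v => (hΘN v).trans (mul_le_mul_of_nonneg_right (by simp) (norm_nonneg v))) z

theorem isStandardFrame_iff_injective_isClosed [CompleteSpace E] (hΘ : IsAnalysisOperator x Θ) :
    IsStandardFrame A x ↔ Function.Injective Θ ∧ IsClosed (Set.range Θ) := by
  rw [hΘ.isStandardFrame_iff, exists_norm_le_iff]

/-- The square of the norm of `u = ∑ j ∈ s, a j • x j` is that of the inner product of `Θ u` with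
the truncation of `a` to `s`. -/
theorem norm_sum_le (hΘ : IsAnalysisOperator x Θ) {M : ℝ} (hM : 0 ≤ M)
    (h : ∀ z, ‖Θ z‖ ≤ M * ‖z‖) (s : Finset J) (a : J → A) :
    ‖∑ j ∈ s, a j • x j‖ ≤ M * ‖L2.ofFinset s a‖ := by
  set u := ∑ j ∈ s, a j • x j with hu
  have e : ∀ v, inner A v u = inner A (Θ v) (L2.ofFinset s a) := fun v => by
    rw [L2.inner_ofFinset_right, hu, CStarModule.inner_sum_right]
    refine Finset.sum_congr rfl fun j _ => ?_
    rw [CStarModule.inner_op_smul_right, hΘ, CStarModule.star_inner]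
  rcases (norm_nonneg u).eq_or_lt with h0 | h0
  · rw [← h0]; positivity
  · refine le_of_mul_le_mul_left ?_ h0
    calc ‖u‖ * ‖u‖ = ‖inner A (Θ u) (L2.ofFinset s a)‖ := by
          rw [← e, ← CStarModule.norm_sq_eq A, sq]
      _ ≤ ‖Θ u‖ * ‖L2.ofFinset s a‖ := CStarModule.norm_inner_le _
      _ ≤ M * ‖u‖ * ‖L2.ofFinset s a‖ := by gcongr; exact h u
      _ = ‖u‖ * (M * ‖L2.ofFinset s a‖) := by ring

theorem summable_smul [CompleteSpace E] (hΘ : IsAnalysisOperator x Θ) (a : L2 A J) :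
    Summable fun j => a.coord j • x j := by
  obtain ⟨M, hM, h⟩ := exists_norm_le_mul Θ
  rw [summable_iff_vanishing_norm]
  intro ε hε
  obtain ⟨s, hs⟩ := summable_iff_vanishing_norm.1 (L2.summable_coord a a) ((ε / (M + 1)) ^ 2)
    (by positivity)
  refine ⟨s, fun t ht => ?_⟩
  have h1 := hs t ht
  rw [← L2.norm_ofFinset_sq] at h1
  have h2 : ‖L2.ofFinset t a.coord‖ < ε / (M + 1) := lt_of_pow_lt_pow_left₀ 2 (by positivity) h1
  calc ‖∑ j ∈ t, a.coord j • x j‖ ≤ M * ‖L2.ofFinset t a.coord‖ := hΘ.norm_sum_le hM h t _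
    _ ≤ (M + 1) * ‖L2.ofFinset t a.coord‖ := by gcongr; simp
    _ < (M + 1) * (ε / (M + 1)) := by gcongr
    _ = ε := by field_simp

/-- The adjoint of the analysis operator is the synthesis operator `a ↦ ∑ j, a j • x j`. -/
theorem exists_adjoint [CompleteSpace E] (hΘ : IsAnalysisOperator x Θ) :
    ∃ S : L2 A J →L[A] E, (∀ z a, inner A (Θ z) a = inner A z (S a)) ∧
      ∀ a, HasSum (fun j => a.coord j • x j) (S a) := by
  have key : ∀ z a, inner A (Θ z) a = inner A z (∑' j, a.coord j • x j) := by
    intro z a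
    have h1 := (hΘ.summable_smul a).hasSum.mapL (CStarModule.innerSL (A := A) z)
    rw [CStarModule.innerSL_apply] at h1
    rw [← h1.tsum_eq, L2.inner_def]
    refine tsum_congr fun j => ?_
    rw [hΘ, CStarModule.star_inner, CStarModule.innerSL_apply, CStarModule.inner_op_smul_right]
  obtain ⟨S, hS⟩ := exists_continuousLinearMap_of_adjoint Θ _ key
  exact ⟨S, fun z a => by rw [hS, key], fun a => by rw [hS]; exact (hΘ.summable_smul a).hasSum⟩

/-- A coefficient family in the kernel of the synthesis operator vanishes, by the independence of
the basis and the triviality of the annihilators. -/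
theorem surjective_of_isHilbertBasis [CompleteSpace E] (hΘ : IsAnalysisOperator x Θ)
    (hx : IsStandardFrame A x) (hb : IsHilbertBasis A x) : Function.Surjective Θ := by
  obtain ⟨S, hS, hsum⟩ := hΘ.exists_adjoint
  obtain ⟨M, hM, h⟩ := hΘ.isStandardFrame_iff.1 hx
  refine surjective_of_adjoint_injective Θ S hS hM h
    ((injective_iff_map_eq_zero S).2 fun a ha => ?_)
  refine L2.ext_coord fun j => hb.annihilator_trivial j _ ?_
  refine hb.independent Set.univ a.coord ?_ j trivial
  have h1 := hsum a
  rw [ha] at h1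
  exact (Equiv.Set.univ J).hasSum_iff.2 h1

/-- If `Θ` is bijective, the vectors `u j` with `Θ (u j) = basisVector j` are biorthogonal to the
family, and pairing with them reads off the coefficients of a linear combination. -/
theorem isHilbertBasis_of_bijective [CompleteSpace E] (hΘ : IsAnalysisOperator x Θ)
    (hbij : Function.Bijective Θ) : IsHilbertBasis A x := by
  have hx : IsStandardFrame A x := hΘ.isStandardFrame_iff_injective_isClosed.2
    ⟨hbij.1, by rw [hbij.2.range_eq]; exact isClosed_univ⟩
  obtain ⟨S, hS, hsum⟩ := hΘ.exists_adjoint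
  obtain ⟨M, hM, h⟩ := hΘ.isStandardFrame_iff.1 hx
  obtain ⟨T, -, hTS⟩ := exists_symmetric_adjoint_comp_eq Θ S hS hM h
  choose u hu using fun j => hbij.2 (L2.basisVector j : L2 A J)
  have huself : ∀ j, inner A (u j) (x j) = 1 := fun j => by
    rw [← CStarModule.star_inner, ← hΘ, hu, L2.coord_basisVector_self, star_one]
  have hune : ∀ i j, i ≠ j → inner A (u j) (x i) = 0 := fun i j hij => by
    rw [← CStarModule.star_inner, ← hΘ, hu, L2.coord_basisVector_of_ne hij, star_zero]
  refine ⟨fun z => ?_, fun R a ha j hj => ?_, fun j a ha => ?_⟩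
  · have h1 := hsum (Θ (T (T z)))
    rw [comp_eq_of_symmetric_comp_eq hTS] at h1
    refine mem_closure_of_tendsto h1 (Filter.Eventually.of_forall fun s => ?_)
    exact Submodule.sum_mem _ fun j _ =>
      Submodule.smul_mem _ _ (Submodule.subset_span ⟨j, rfl⟩)
  · have h1 := ha.mapL (CStarModule.innerSL (A := A) (u j))
    rw [map_zero] at h1
    have h2 := h1.unique (hasSum_single (⟨j, hj⟩ : R) fun i hi => by
      rw [CStarModule.innerSL_apply, CStarModule.inner_op_smul_right,
        hune _ _ fun h => hi (Subtype.ext h), mul_zero])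
    rw [CStarModule.innerSL_apply, CStarModule.inner_op_smul_right, huself, mul_one] at h2
    rw [← h2, zero_smul]
  · have h1 : inner A (u j) (a • x j) = 0 := by rw [ha, CStarModule.inner_zero_right]
    rwa [CStarModule.inner_op_smul_right, huself, mul_one] at h1

theorem isStandardRieszBasis_iff [CompleteSpace E] (hΘ : IsAnalysisOperator x Θ) :
    IsStandardRieszBasis A x ↔ Function.Bijective Θ := by
  constructor
  · rintro ⟨hx, hb⟩
    exact ⟨(hΘ.isStandardFrame_iff_injective_isClosed.1 hx).1,
      hΘ.surjective_of_isHilbertBasis hx hb⟩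
  · intro h
    exact ⟨hΘ.isStandardFrame_iff_injective_isClosed.2
      ⟨h.1, by rw [h.2.range_eq]; exact isClosed_univ⟩, hΘ.isHilbertBasis_of_bijective h⟩

/-- A surjective isometric analysis operator is unitary and maps the family to the standard
orthonormal basis of `l₂(A)`. -/
theorem isOrthogonalHilbertBasis_of_surjective [CompleteSpace E] (hΘ : IsAnalysisOperator x Θ)
    (hiso : ∀ z, inner A (Θ z) (Θ z) = inner A z z) (hsurj : Function.Surjective Θ) :
    IsOrthogonalHilbertBasis A x := by
  have hinj : Function.Injective Θ := (injective_iff_map_eq_zero Θ).2 fun z hz => by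
    have h := hiso z
    rw [hz, (CStarModule.inner_self (A := A) (E := L2 A J)).2 rfl] at h
    exact CStarModule.inner_self.1 h.symm
  have hΘx : ∀ j, Θ (x j) = L2.basisVector j := fun j => by
    obtain ⟨u, hu⟩ := hsurj (L2.basisVector j)
    have : x j = u := eq_of_forall_inner_right A fun v => by
      have h := inner_map_map_of_inner_self (Θ : E →ₗ[A] L2 A J) hiso v u
      rw [← h, ContinuousLinearMap.coe_coe, hu, L2.inner_basisVector_right, hΘ,
        CStarModule.star_inner]
    rw [this, hu]
  refine ⟨hΘ.isHilbertBasis_of_bijective ⟨hinj, hsurj⟩, fun i j hij => ?_⟩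
  rw [← hΘ, hΘx, L2.coord_basisVector_of_ne hij]

end IsAnalysisOperator

end Analysis

/-! ### Inner sums of frames -/

section InnerSum

variable {A : Type*} [CStarAlgebra A] [PartialOrder A] [StarOrderedRing A] {J : Type*}
variable {E : Type*} [NormedAddCommGroup E] [NormedSpace ℂ E] [Module A E] [CStarModule A E]
variable {F : Type*} [NormedAddCommGroup F] [NormedSpace ℂ F] [Module A F] [CStarModule A F]

/-- The operator `h ⊕ k ↦ Θ₁ h + Θ₂ k` on the Hilbert module `E ⊕ F`. -/
noncomputable def sumOperator (Θ₁ : E →L[A] L2 A J) (Θ₂ : F →L[A] L2 A J) :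
    C⋆ᵐᵒᵈ(A, E × F) →L[A] L2 A J :=
  (Θ₁.coprod Θ₂).comp (WithCStarModule.equivL A : C⋆ᵐᵒᵈ(A, E × F) ≃L[A] E × F).toContinuousLinearMap

variable {Θ₁ : E →L[A] L2 A J} {Θ₂ : F →L[A] L2 A J} {x : J → E} {y : J → F}

theorem sumOperator_apply (v : C⋆ᵐᵒᵈ(A, E × F)) :
    sumOperator Θ₁ Θ₂ v = Θ₁ v.1 + Θ₂ v.2 := rfl

theorem IsAnalysisOperator.innerSum (h₁ : IsAnalysisOperator x Θ₁)
    (h₂ : IsAnalysisOperator y Θ₂) :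
    IsAnalysisOperator (innerSum A x y) (sumOperator Θ₁ Θ₂) := fun v j => by
  rw [sumOperator_apply, L2.coord_add, h₁, h₂]
  rfl

theorem range_sumOperator : (sumOperator Θ₁ Θ₂ : C⋆ᵐᵒᵈ(A, E × F) →ₗ[A] L2 A J).range =
    (Θ₁ : E →ₗ[A] L2 A J).range ⊔ (Θ₂ : F →ₗ[A] L2 A J).range := by
  ext w
  rw [Submodule.mem_sup]
  constructor
  · rintro ⟨v, rfl⟩
    exact ⟨_, ⟨v.1, rfl⟩, _, ⟨v.2, rfl⟩, rfl⟩
  · rintro ⟨_, ⟨h, rfl⟩, _, ⟨k, rfl⟩, rfl⟩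
    exact ⟨(WithCStarModule.equiv A (E × F)).symm (h, k), rfl⟩

theorem injective_sumOperator_iff (h₁ : Function.Injective Θ₁) (h₂ : Function.Injective Θ₂) :
    Function.Injective (sumOperator Θ₁ Θ₂) ↔
      (Θ₁ : E →ₗ[A] L2 A J).range ⊓ (Θ₂ : F →ₗ[A] L2 A J).range = ⊥ := by
  rw [injective_iff_map_eq_zero, Submodule.eq_bot_iff]
  constructor
  · rintro h _ ⟨⟨a, rfl⟩, ⟨b, hb⟩⟩
    have h3 := h ((WithCStarModule.equiv A (E × F)).symm (a, -b)) (by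
      rw [sumOperator_apply]
      change Θ₁ a + Θ₂ (-b) = 0
      rw [map_neg, ← sub_eq_add_neg, sub_eq_zero]
      exact hb.symm)
    have h4 : a = 0 := congrArg (fun v : C⋆ᵐᵒᵈ(A, E × F) => v.1) h3
    rw [h4, map_zero]
  · intro h v hv
    rw [sumOperator_apply] at hv
    have h3 : Θ₁ v.1 = 0 := h _ ⟨⟨v.1, rfl⟩, ⟨-v.2, by
      rw [map_neg]; exact (eq_neg_of_add_eq_zero_left hv).symm⟩⟩
    have h4 : Θ₂ v.2 = 0 := by rwa [h3, zero_add] at hv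
    exact Prod.ext (h₁ (h3.trans (map_zero _).symm)) (h₂ (h4.trans (map_zero _).symm))

theorem weaklyDisjoint_iff (h₁ : IsAnalysisOperator x Θ₁) (h₂ : IsAnalysisOperator y Θ₂) :
    WeaklyDisjoint A x y ↔ Function.Injective (sumOperator Θ₁ Θ₂) := by
  rw [injective_iff_map_eq_zero]
  refine forall_congr' fun v => imp_congr_left ?_
  simp only [← h₁.innerSum h₂ v]
  exact ⟨fun h => L2.ext_coord h, fun h j => by rw [h, L2.coord_zero]⟩

/-- For isometric `Θ₁` and `Θ₂`, the inner sum is again isometric exactly if their ranges are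
orthogonal: polarization for `h ⊕ 0` and `0 ⊕ k` gives one direction, Pythagoras the other. -/
theorem inner_sumOperator_self_iff (h₁ : ∀ z, inner A (Θ₁ z) (Θ₁ z) = inner A z z)
    (h₂ : ∀ z, inner A (Θ₂ z) (Θ₂ z) = inner A z z) :
    (∀ v, inner A (sumOperator Θ₁ Θ₂ v) (sumOperator Θ₁ Θ₂ v) = inner A v v) ↔
      ∀ h k, inner A (Θ₁ h) (Θ₂ k) = 0 := by
  constructor
  · intro hiso h k
    have e := inner_map_map_of_inner_self (sumOperator Θ₁ Θ₂ : C⋆ᵐᵒᵈ(A, E × F) →ₗ[A] L2 A J) hiso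
      ((WithCStarModule.equiv A (E × F)).symm (h, 0))
      ((WithCStarModule.equiv A (E × F)).symm (0, k))
    have e1 : sumOperator Θ₁ Θ₂ ((WithCStarModule.equiv A (E × F)).symm (h, 0)) = Θ₁ h := by
      rw [sumOperator_apply]; simp
    have e2 : sumOperator Θ₁ Θ₂ ((WithCStarModule.equiv A (E × F)).symm (0, k)) = Θ₂ k := by
      rw [sumOperator_apply]; simp
    rw [ContinuousLinearMap.coe_coe, e1, e2] at e
    rw [e, WithCStarModule.prod_inner]
    simp
  · intro h v
    rw [sumOperator_apply, WithCStarModule.prod_inner, ← h₁, ← h₂]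
    exact inner_add_self_of_inner_eq_zero (h _ _)

/-- Every standard frame is similar, through a symmetric operator `T`, to the normalized tight
frame with analysis operator `Θ T`. -/
theorem IsAnalysisOperator.exists_similar_tight [CompleteSpace E] (hΘ : IsAnalysisOperator x Θ₁)
    (hx : IsStandardFrame A x) :
    ∃ T : E ≃L[A] E, IsAdjointable (T : E →L[A] E) ∧
      IsAnalysisOperator (fun j => T (x j)) (Θ₁.comp (T : E →L[A] E)) ∧
      ∀ z, inner A (Θ₁ (T z)) (Θ₁ (T z)) = inner A z z := by
  obtain ⟨S, hS, -⟩ := hΘ.exists_adjoint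
  obtain ⟨M, hM, h⟩ := hΘ.isStandardFrame_iff.1 hx
  obtain ⟨T, hT, hTS⟩ := exists_symmetric_adjoint_comp_eq Θ₁ S hS hM h
  refine ⟨T, ⟨T, hT⟩, fun z j => ?_, fun z => ?_⟩
  · exact (hΘ (T z) j).trans (hT _ _).symm
  · rw [hS, hT, hTS]

theorem IsAnalysisOperator.comp_adjoint (hΘ : IsAnalysisOperator x Θ₁) {T S : E →L[A] E}
    (hS : ∀ z w, inner A (T z) w = inner A z (S w)) {z : J → E} (hz : ∀ j, T (x j) = z j) :
    IsAnalysisOperator z (Θ₁.comp S) := fun w j => by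
  rw [← hz, hS]; exact hΘ _ _

/-- If `S` is the adjoint of an injective operator `T` and `Θ₁ S` has range orthogonal to `w`, then
so has `Θ₁`. -/
theorem inner_eq_zero_of_comp_adjoint [CompleteSpace E] (hΘ : IsAnalysisOperator x Θ₁)
    {T S : E →L[A] E} (hS : ∀ z w, inner A (T z) w = inner A z (S w))
    (hT : Function.Injective T) {w : L2 A J} (h : ∀ u, inner A (Θ₁ (S u)) w = 0) (u : E) :
    inner A (Θ₁ u) w = 0 := by
  obtain ⟨R, hR, -⟩ := hΘ.exists_adjoint
  have h1 : T (R w) = 0 := eq_zero_of_forall_inner_right A fun v => inner_swap_eq_zero <| by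
    rw [hS]
    exact inner_swap_eq_zero ((hR _ _).symm.trans (h v))
  rw [hR, hT (h1.trans (map_zero T).symm), CStarModule.inner_zero_right]

/-- Pairs similar to a pair of tight frames with tight inner sum have orthogonal analysis ranges:
the inner sum being tight, the analysis operators of the tight frames are orthogonal isometries. -/
theorem inner_eq_zero_of_stronglyDisjoint [CompleteSpace E] [CompleteSpace F]
    (h₁ : IsAnalysisOperator x Θ₁) (h₂ : IsAnalysisOperator y Θ₂)
    (h : StronglyDisjoint A x y) (u : E) (v : F) : inner A (Θ₁ u) (Θ₂ v) = 0 := by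
  obtain ⟨z, w, ⟨T₁, T₂, ⟨S₁, hS₁⟩, ⟨S₂, hS₂⟩, hzw⟩, hz, hw, ht⟩ := h
  have hz' := h₁.comp_adjoint hS₁ fun j => (hzw j).1
  have hw' := h₂.comp_adjoint hS₂ fun j => (hzw j).2
  have key := (inner_sumOperator_self_iff (hz'.isStandardNormalizedTightFrame_iff.1 hz)
    (hw'.isStandardNormalizedTightFrame_iff.1 hw)).1
    ((hz'.innerSum hw').isStandardNormalizedTightFrame_iff.1 ht)
  refine inner_eq_zero_of_comp_adjoint h₁ hS₁ T₁.injective (fun u' => ?_) u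
  exact inner_swap_eq_zero (inner_eq_zero_of_comp_adjoint h₂ hS₂ T₂.injective
    (fun v' => inner_swap_eq_zero (key u' v')) v)

theorem stronglyDisjoint_iff [CompleteSpace E] [CompleteSpace F]
    (h₁ : IsAnalysisOperator x Θ₁) (h₂ : IsAnalysisOperator y Θ₂)
    (hx : IsStandardFrame A x) (hy : IsStandardFrame A y) :
    StronglyDisjoint A x y ↔ ∀ u v, inner A (Θ₁ u) (Θ₂ v) = 0 := by
  refine ⟨inner_eq_zero_of_stronglyDisjoint h₁ h₂, fun h => ?_⟩
  obtain ⟨T₁, hT₁, hz, hiso₁⟩ := h₁.exists_similar_tight hx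
  obtain ⟨T₂, hT₂, hw, hiso₂⟩ := h₂.exists_similar_tight hy
  exact ⟨_, _, ⟨T₁, T₂, hT₁, hT₂, fun j => ⟨rfl, rfl⟩⟩,
    hz.isStandardNormalizedTightFrame_iff.2 hiso₁, hw.isStandardNormalizedTightFrame_iff.2 hiso₂,
    (hz.innerSum hw).isStandardNormalizedTightFrame_iff.2
      ((inner_sumOperator_self_iff hiso₁ hiso₂).2 fun u v => h _ _)⟩

theorem stronglyComplementary_iff [CompleteSpace E] [CompleteSpace F]
    (h₁ : IsAnalysisOperator x Θ₁) (h₂ : IsAnalysisOperator y Θ₂)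
    (hx : IsStandardFrame A x) (hy : IsStandardFrame A y) :
    StronglyComplementary A x y ↔ (∀ u v, inner A (Θ₁ u) (Θ₂ v) = 0) ∧
      (Θ₁ : E →ₗ[A] L2 A J).range ⊔ (Θ₂ : F →ₗ[A] L2 A J).range = ⊤ := by
  constructor
  · rintro ⟨z, w, hsim, hz, hw, ht, hb⟩
    refine ⟨inner_eq_zero_of_stronglyDisjoint h₁ h₂ ⟨z, w, hsim, hz, hw, ht⟩, ?_⟩
    obtain ⟨T₁, T₂, ⟨S₁, hS₁⟩, ⟨S₂, hS₂⟩, hzw⟩ := hsim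
    have hs := (h₁.comp_adjoint hS₁ fun j => (hzw j).1).innerSum
      (h₂.comp_adjoint hS₂ fun j => (hzw j).2)
    refine eq_top_iff.2 fun v _ => ?_
    obtain ⟨p, rfl⟩ := hs.surjective_of_isHilbertBasis ⟨1, 1, one_pos, one_pos, ht⟩ hb.1 v
    exact Submodule.mem_sup.2 ⟨_, ⟨S₁ p.1, rfl⟩, _, ⟨S₂ p.2, rfl⟩, rfl⟩
  · rintro ⟨h, htop⟩
    obtain ⟨T₁, hT₁, hz, hiso₁⟩ := h₁.exists_similar_tight hx
    obtain ⟨T₂, hT₂, hw, hiso₂⟩ := h₂.exists_similar_tight hy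
    have hs := hz.innerSum hw
    have hiso := (inner_sumOperator_self_iff (Θ₁ := Θ₁.comp (T₁ : E →L[A] E))
      (Θ₂ := Θ₂.comp (T₂ : F →L[A] F)) hiso₁ hiso₂).2 fun u v => h _ _
    refine ⟨_, _, ⟨T₁, T₂, hT₁, hT₂, fun j => ⟨rfl, rfl⟩⟩,
      hz.isStandardNormalizedTightFrame_iff.2 hiso₁,
      hw.isStandardNormalizedTightFrame_iff.2 hiso₂,
      hs.isStandardNormalizedTightFrame_iff.2 hiso,
      hs.isOrthogonalHilbertBasis_of_surjective hiso fun v => ?_⟩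
    obtain ⟨_, ⟨a, rfl⟩, _, ⟨b, rfl⟩, rfl⟩ := Submodule.mem_sup.1
      (htop ▸ Submodule.mem_top : v ∈ (Θ₁ : E →ₗ[A] L2 A J).range ⊔ (Θ₂ : F →ₗ[A] L2 A J).range)
    refine ⟨(WithCStarModule.equiv A (E × F)).symm (T₁.symm a, T₂.symm b), ?_⟩
    rw [sumOperator_apply]
    simp

end InnerSum

theorem mainTheorem1 {A : Type*} [CStarAlgebra A] [PartialOrder A] [StarOrderedRing A]
    {J : Type*} [Countable J]
    {H : Type*} [NormedAddCommGroup H] [NormedSpace ℂ H] [Module A H] [CStarModule A H]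
    [CompleteSpace H]
    {K : Type*} [NormedAddCommGroup K] [NormedSpace ℂ K] [Module A K] [CStarModule A K]
    [CompleteSpace K]
    (x : J → H) (y : J → K) (hx : IsStandardFrame A x) (hy : IsStandardFrame A y)
    (hsum : UnitarilyIsomorphic A C⋆ᵐᵒᵈ(A, H × K) (L2 A ℕ)) :
    (∃! P : L2 A J →L[A] L2 A J, IsOrthogonalProjectionOnto P (frameTransform x hx).range) ∧
    (∃! Q : L2 A J →L[A] L2 A J, IsOrthogonalProjectionOnto Q (frameTransform y hy).range) ∧
    ∀ P Q : L2 A J →L[A] L2 A J,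
      IsOrthogonalProjectionOnto P (frameTransform x hx).range →
      IsOrthogonalProjectionOnto Q (frameTransform y hy).range →
      (StronglyComplementary A x y ↔ P = 1 - Q) ∧
      ((Complementary A x y ↔
          P.range ⊓ Q.range = ⊥ ∧ P.range ⊔ Q.range = ⊤) ∧
        (Complementary A x y ↔
          P.range ⊓ Q.range = ⊥ ∧ IsUnit (P + Q))) ∧
      (StronglyDisjoint A x y ↔ P * Q = 0 ∧ Q * P = 0) ∧
      (DisjointFrames A x y ↔
        P.range ⊓ Q.range = ⊥ ∧ IsClosed ((P.range ⊔ Q.range : Submodule A (L2 A J)) : Set (L2 A J))) ∧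
      (WeaklyDisjoint A x y ↔ P.range ⊓ Q.range = ⊥) := by
  obtain ⟨Θ₁, h₁, hr₁⟩ := hx.exists_isAnalysisOperator
  obtain ⟨Θ₂, h₂, hr₂⟩ := hy.exists_isAnalysisOperator
  obtain ⟨M₁, hM₁, hb₁⟩ := h₁.isStandardFrame_iff.1 hx
  obtain ⟨M₂, hM₂, hb₂⟩ := h₂.isStandardFrame_iff.1 hy
  have hinj := injective_sumOperator_iff
    (h₁.isStandardFrame_iff_injective_isClosed.1 hx).1
    (h₂.isStandardFrame_iff_injective_isClosed.1 hy).1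
  rw [← hr₁, ← hr₂]
  refine ⟨?_, ?_, fun P Q hP hQ => ?_⟩
  · obtain ⟨S, hS, -⟩ := h₁.exists_adjoint
    obtain ⟨P, hP⟩ := exists_isOrthogonalProjectionOnto_range Θ₁ S hS hM₁ hb₁
    exact ⟨P, hP, fun P' hP' => hP'.unique hP⟩
  · obtain ⟨S, hS, -⟩ := h₂.exists_adjoint
    obtain ⟨Q, hQ⟩ := exists_isOrthogonalProjectionOnto_range Θ₂ S hS hM₂ hb₂
    exact ⟨Q, hQ, fun Q' hQ' => hQ'.unique hQ⟩
  have hPQ : P * Q = 0 ↔ ∀ u v, inner A (Θ₁ u) (Θ₂ v) = 0 := by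
    rw [hP.mul_eq_zero_iff hQ]
    constructor
    · exact fun h u v => h _ ⟨u, rfl⟩ _ ⟨v, rfl⟩
    · rintro h _ ⟨u, rfl⟩ _ ⟨v, rfl⟩
      exact h u v
  have hcompl : Complementary A x y ↔
      (Θ₁ : H →ₗ[A] L2 A J).range ⊓ (Θ₂ : K →ₗ[A] L2 A J).range = ⊥ ∧
      (Θ₁ : H →ₗ[A] L2 A J).range ⊔ (Θ₂ : K →ₗ[A] L2 A J).range = ⊤ := by
    rw [Complementary, (h₁.innerSum h₂).isStandardRieszBasis_iff, ← hinj, ← range_sumOperator,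
      LinearMap.range_eq_top]
    rfl
  rw [hP.range_eq, hQ.range_eq]
  refine ⟨?_, ⟨hcompl, ?_⟩, ?_, ?_, ?_⟩
  · rw [stronglyComplementary_iff h₁ h₂ hx hy, hP.eq_one_sub_iff hQ, hPQ]
  · rw [hcompl, hP.isUnit_add_iff hQ]
  · rw [stronglyDisjoint_iff h₁ h₂ hx hy, ← hP.mul_eq_zero_comm hQ, and_self, hPQ]
  · rw [DisjointFrames, (h₁.innerSum h₂).isStandardFrame_iff_injective_isClosed, hinj,
      ← range_sumOperator]
    rfl
  · rw [weaklyDisjoint_iff h₁ h₂, hinj]
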